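/- Let $C(G,T)$ be an embedded flat clustered graph: $G=(V,E)$ is a finite connected simple graph with a fixed planar embedding (given by the circular order of the edges around each vertex), and some of the vertices are distributed among non-empty, pairwise disjoint clusters. For a cluster $\alpha$, let $G[\alpha]$ be the subgraph of $G$ induced by the vertices in $\alpha$. A *con-edge* for $\alpha$ is an unordered pair of occurrences, on the boundary of one and the same face of $G$, of vertices that belong to $\alpha$ and lie in different connected components of $G[\alpha]$. Two con-edges in the same face *have a conflict* (or *cross*) if their occurrences alternate along the boundary of this face. The *multigraph of the con-edges* has as vertices the connected components of the graphs $G[\alpha]$, over all clusters $\alpha$, and as edges all con-edges. Let $A$ be the multigraph of the con-edges of $C$, or any multigraph obtained from it by removing con-edges and by contracting con-edges that cross no other con-edge present (contracting a con-edge identifies its end-vertices and deletes it). The *conflict graph* $K_A$ has a vertex for each con-edge of $A$ and an edge between any two con-edges of $A$ that have a conflict. Assume that no two distinct con-edges of $A$ for the same cluster belong to the same connected component of $K_A$. A *planar set of spanning trees for $A$* is a set $S$ of con-edges of $A$, no two of which have a conflict, such that for each cluster $\alpha$ the con-edges for $\alpha$ in $S$ form a tree spanning all the vertices of $A$ that stem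 from $\alpha$. If $K_A$ is not bipartite, then there exists no planar set of spanning trees for $A$. -/

import Mathlib

/-- The face permutation `d ↦ rot d.symm` of a rotation system `rot`: walking along the boundary
of a face, the dart `d` is followed by the dart `rot d.symm`, which leaves the vertex that `d`
enters. -/
def facePerm {V : Type*} (G : SimpleGraph V) (rot : Equiv.Perm G.Dart) : Equiv.Perm G.Dart :=
  (Function.Involutive.toPerm SimpleGraph.Dart.symm SimpleGraph.Dart.symm_involutive).trans rot

/-- An embedded flat clustered graph with underlying vertex set `V` and cluster set `κ`.
The planar embedding of the (connected) underlying graph is given, as usual, by a rotation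
system: `rot` lists, for every vertex, the darts leaving this vertex in their circular order.
Planarity of the rotation system is Euler's formula, where the faces are the orbits of the
permutation `facePerm graph rot` of the darts.  The flat inclusion tree is given by its parent map:
`cluster v = some α` says that `v` is a child of the cluster `α`, and `cluster v = none` that `v`
is a child of the root; every cluster, being an inner node of the tree, has a vertex. -/
structure EmbeddedFlatClusteredGraph (V κ : Type*) where
  /-- the underlying graph -/
  graph : SimpleGraph V
  connected : graph.Connected
  /-- the next dart around the source vertex of a dart -/
  rot : Equiv.Perm graph.Dart
  rot_sameCycle : ∀ d d' : graph.Dart, rot.SameCycle d d' ↔ d.fst = d'.fst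
  /-- Euler's formula (a graph without edges is a single vertex and is always plane) -/
  euler : graph.edgeSet.Nonempty →
    Nat.card V + Nat.card (Quotient (Equiv.Perm.SameCycle.setoid (facePerm graph rot))) =
      Nat.card graph.edgeSet + 2
  /-- the cluster a vertex belongs to, if any -/
  cluster : V → Option κ
  cluster_nonempty : ∀ α : κ, ∃ v, cluster v = some α

namespace EmbeddedFlatClusteredGraph

variable {V κ : Type*} (C : EmbeddedFlatClusteredGraph V κ)

/-- The face permutation of `C`. -/
def face : Equiv.Perm C.graph.Dart := facePerm C.graph C.rot

/-- A face is an orbit of `C.face`.  The dart `d` stands for the occurrence of the vertex `d.fst`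
on the boundary of the face whose boundary walk passes through `d`; so the circular order of the
occurrences along the boundary of the face of `d` is `d, C.face d, C.face (C.face d), …`. -/
abbrev Occurrence : Type _ := C.graph.Dart

/-- The occurrences `a, b, c, d` are pairwise distinct, belong to the same face, and appear in
this circular order along its boundary. -/
def InCyclicOrder (a b c d : C.Occurrence) : Prop :=
  ∃ i j k : ℕ, 0 < i ∧ i < j ∧ j < k ∧ k < Function.minimalPeriod C.face a ∧
    b = C.face^[i] a ∧ c = C.face^[j] a ∧ d = C.face^[k] a

/-- The subgraph `G[α]` of the underlying graph induced by the vertices in the cluster `α`. -/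
def clusterGraph (α : κ) : SimpleGraph {v : V // C.cluster v = some α} :=
  C.graph.comap Subtype.val

/-- `e` is a con-edge for `α`: an unordered pair of occurrences, on the boundary of the same face,
of (distinct) vertices in `α` that lie in different connected components of `G[α]`. -/
def IsConEdgeFor (α : κ) (e : Sym2 C.Occurrence) : Prop :=
  ∃ (a b : C.Occurrence) (ha : C.cluster a.fst = some α) (hb : C.cluster b.fst = some α),
    e = s(a, b) ∧ C.face.SameCycle a b ∧
      ¬ (C.clusterGraph α).Reachable ⟨a.fst, ha⟩ ⟨b.fst, hb⟩

/-- `e` is a con-edge. -/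
def IsConEdge (e : Sym2 C.Occurrence) : Prop := ∃ α, C.IsConEdgeFor α e

/-- Two con-edges have a conflict: they lie in the same face and their occurrences alternate
along the boundary of this face. -/
def Conflict (e e' : Sym2 C.Occurrence) : Prop :=
  ∃ a b c d : C.Occurrence, e = s(a, c) ∧ e' = s(b, d) ∧ C.InCyclicOrder a b c d

/-- The two end-vertices of a pair of occurrences. -/
def ends (e : Sym2 C.Occurrence) : Sym2 V := e.map fun o => o.fst

variable {C}

theorem InCyclicOrder.rotate {a b c d : C.Occurrence} (h : C.InCyclicOrder a b c d) :
    C.InCyclicOrder b c d a := by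
  obtain ⟨i, j, k, hi, hij, hjk, hk, rfl, rfl, rfl⟩ := h
  have hp : a ∈ Function.periodicPts C.face :=
    Function.minimalPeriod_pos_iff_mem_periodicPts.1 (by omega)
  refine ⟨j - i, k - i, Function.minimalPeriod C.face a - i, by omega, by omega, by omega, ?_,
    ?_, ?_, ?_⟩
  · rw [Function.minimalPeriod_apply_iterate hp]; omega
  · rw [← Function.iterate_add_apply]; congr 1; omega
  · rw [← Function.iterate_add_apply]; congr 1; omega
  · rw [← Function.iterate_add_apply, Nat.sub_add_cancel (by omega),
      Function.iterate_minimalPeriod]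

theorem InCyclicOrder.ne_fst_snd {a b c d : C.Occurrence} (h : C.InCyclicOrder a b c d) :
    a ≠ b := by
  obtain ⟨i, j, k, hi, hij, hjk, hk, rfl, rfl, rfl⟩ := h
  intro h
  have : Function.IsPeriodicPt C.face i a := h.symm
  have := this.minimalPeriod_le hi
  omega

theorem Conflict.symm {e e' : Sym2 C.Occurrence} (h : C.Conflict e e') : C.Conflict e' e := by
  obtain ⟨a, b, c, d, rfl, rfl, h⟩ := h
  exact ⟨b, c, d, a, rfl, Sym2.eq_swap, h.rotate⟩

theorem not_conflict_self (e : Sym2 C.Occurrence) : ¬ C.Conflict e e := by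
  rintro ⟨a, b, c, d, rfl, h, hc⟩
  rcases Sym2.eq_iff.1 h with ⟨h1, _⟩ | ⟨h1, _⟩
  · exact hc.ne_fst_snd h1
  · exact hc.rotate.rotate.rotate.ne_fst_snd h1.symm

end EmbeddedFlatClusteredGraph

/-- A multigraph `A` of con-edges for `C`: it arises from the multigraph of all con-edges of `C`
by removing some con-edges and by contracting some con-edges that cross no other con-edge left.
`edges` is the set of con-edges of `A`, `contracted` the set of the contracted ones; all other
con-edges of `C` have been removed.  The multigraph of all con-edges of `C` is the case in which
`edges` consists of all con-edges of `C` and `contracted` is empty. -/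
structure ConEdgeMultigraph {V κ : Type*} (C : EmbeddedFlatClusteredGraph V κ) where
  edges : Set (Sym2 C.Occurrence)
  contracted : Set (Sym2 C.Occurrence)
  isConEdge : ∀ e ∈ edges ∪ contracted, C.IsConEdge e
  disjoint : Disjoint edges contracted
  not_conflict : ∀ e ∈ contracted, ∀ e' ∈ edges ∪ contracted, ¬ C.Conflict e e'

namespace ConEdgeMultigraph

variable {V κ : Type*} {C : EmbeddedFlatClusteredGraph V κ} (A : ConEdgeMultigraph C)

/-- The graph on the vertices in `α` formed by the edges of `G[α]` and by the contracted
con-edges for `α`. -/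
def contractionGraph (α : κ) : SimpleGraph {v : V // C.cluster v = some α} :=
  C.clusterGraph α ⊔ SimpleGraph.fromRel fun u v => ∃ e ∈ A.contracted, C.ends e = s(u.1, v.1)

/-- The vertices of `A[α]`: every connected component of `G[α]` is contracted into a single
vertex, and so are the contracted con-edges for `α`. -/
abbrev Vertex (α : κ) : Type _ := (A.contractionGraph α).ConnectedComponent

/-- The pair of occurrences `e` joins the vertices `x` and `y` of `A[α]`. -/
def Joins {α : κ} (e : Sym2 C.Occurrence) (x y : A.Vertex α) : Prop :=
  ∃ u v : {v : V // C.cluster v = some α}, C.ends e = s(u.1, v.1) ∧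
    (A.contractionGraph α).connectedComponentMk u = x ∧
    (A.contractionGraph α).connectedComponentMk v = y

/-- The set `S[α]` of the edges in `S` that are con-edges for `α` is a tree spanning all vertices
of `A[α]`: no edge is a self-loop, no two edges are parallel, and the resulting simple graph on
the vertices of `A[α]` is a tree. -/
def IsSpanningTree (S : Set (Sym2 C.Occurrence)) (α : κ) : Prop :=
  (∀ e ∈ S, ∀ x : A.Vertex α, ¬ A.Joins e x x) ∧
  (∀ e ∈ S, ∀ e' ∈ S, ∀ x y : A.Vertex α, A.Joins e x y → A.Joins e' x y → e = e') ∧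
  (SimpleGraph.fromRel fun x y : A.Vertex α => ∃ e ∈ S, A.Joins e x y).IsTree

/-- `S` is a planar set of spanning trees for `A`. -/
structure IsPlanarSetOfSpanningTrees (S : Set (Sym2 C.Occurrence)) : Prop where
  subset : S ⊆ A.edges
  isSpanningTree : ∀ α : κ, A.IsSpanningTree S α
  not_conflict : ∀ e ∈ S, ∀ e' ∈ S, ¬ C.Conflict e e'

/-- The conflict graph `K_A`. -/
def conflictGraph : SimpleGraph A.edges where
  Adj e e' := C.Conflict e.1 e'.1
  symm := ⟨fun _ _ h => h.symm⟩
  loopless := ⟨fun e => C.not_conflict_self e.1⟩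

/-- No two con-edges of `A` for the same cluster belong to the same connected component of the
conflict graph. -/
def SeparatesClusters : Prop :=
  ∀ (α : κ) (e e' : A.edges), C.IsConEdgeFor α e.1 → C.IsConEdgeFor α e'.1 →
    A.conflictGraph.Reachable e e' → e = e'

end ConEdgeMultigraph

/-! Membership in a planar set `S` of spanning trees is a proper two-colouring of the conflict
graph. Adjacent con-edges are not both in `S`, since `S` is free of conflicts; that they are not
both outside `S` is `IsPlanarSetOfSpanningTrees.mem_or_mem`, which carries the proof.

Suppose that e = ac for α and e' = bd for β cross and both are missing from `S`. The component
hypothesis gives α ≠ β. Edges of G[α], contracted con-edges and the tree of α contain a curve from c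
to a, and e closes it. Another con-edge for α crossing e' would lie in the component of e, so the
closed curve meets e' only in e, once, and b and d are on different sides. Symmetrically, the tree
of β joins b to d without meeting the curve, a contradiction.

The Jordan curve argument is homological modulo two: by Euler's formula every cycle is a sum of face
boundaries (`exists_face_potential`). A chord in a face is replaced by an arc of the face boundary,
and `IsChain.exists_side` corrects the resulting two-colouring of the faces by the arcs, which turns
it into a colouring of the vertices outside α. -/

open Finset in
theorem SimpleGraph.sum_dart_edge_eq {V M : Type*} [AddCommMonoid M] {G : SimpleGraph V}
    [Fintype G.Dart] [DecidableEq G.edgeSet] (f : G.Dart → M) (d : G.Dart) :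
    ∑ d' with (⟨d'.edge, d'.edge_mem⟩ : G.edgeSet) = ⟨d.edge, d.edge_mem⟩, f d' =
      f d + f d.symm := by
  classical
  have : (univ.filter fun d' : G.Dart =>
      (⟨d'.edge, d'.edge_mem⟩ : G.edgeSet) = ⟨d.edge, d.edge_mem⟩) = {d, d.symm} := by
    ext d'
    simp [SimpleGraph.dart_edge_eq_iff]
  rw [this, sum_pair d.symm_ne.symm]

/-- A function on the vertices of a connected graph that agrees on adjacent vertices is
constant. -/
theorem SimpleGraph.Connected.eq_of_forall_adj {V X : Type*} {G : SimpleGraph V}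
    (hG : G.Connected) {f : V → X} (hf : ∀ u v, G.Adj u v → f u = f v) (u v : V) : f u = f v := by
  obtain ⟨p⟩ := hG.preconnected u v
  induction p with
  | nil => rfl
  | cons h _ ih => exact (hf _ _ h).trans ih

/-! ### Cycles and face boundaries modulo two -/

namespace EmbeddedFlatClusteredGraph

variable {V κ : Type*} (C : EmbeddedFlatClusteredGraph V κ)

theorem face_apply (d : C.graph.Dart) : C.face d = C.rot d.symm := rfl

theorem face_symm (d : C.graph.Dart) : C.face d.symm = C.rot d := by
  rw [face_apply, SimpleGraph.Dart.symm_symm]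

theorem rot_fst (d : C.graph.Dart) : (C.rot d).fst = d.fst :=
  ((C.rot_sameCycle d (C.rot d)).1 (Equiv.Perm.sameCycle_apply_right.2 (.refl _ _))).symm

theorem face_fst (d : C.graph.Dart) : (C.face d).fst = d.snd := by
  rw [face_apply, rot_fst]; rfl

variable {C}

/-- A function on darts that is invariant under `rot` around a vertex only depends on it. -/
theorem eq_of_rot_invariant [Finite V] {X : Type*} {s : C.graph.Dart → X} {v : V}
    (hs : ∀ d, d.fst = v → s (C.rot d) = s d) {d d' : C.graph.Dart}
    (hd : d.fst = v) (hd' : d'.fst = v) : s d = s d' := by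
  classical
  have := Fintype.ofFinite V
  have : Finite C.graph.Dart := Finite.of_injective SimpleGraph.Dart.toProd
    SimpleGraph.Dart.toProd_injective
  obtain ⟨n, rfl⟩ := ((C.rot_sameCycle d d').2 (hd.trans hd'.symm)).exists_nat_pow_eq
  clear hd'
  induction n with
  | zero => rfl
  | succ n ih =>
    rw [pow_succ', Equiv.Perm.mul_apply, hs, ih]
    rw [← hd]
    exact ((C.rot_sameCycle _ _).1 ⟨n, by simp⟩).symm

open Finset in
/-- Every cycle modulo two of a plane graph is a sum of boundaries of faces. -/
theorem exists_face_potential [Finite V] [Fintype C.graph.Dart] [DecidableEq V]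
    (w : C.graph.Dart → ZMod 2) (hw : ∀ d, w d.symm = w d)
    (hcycle : ∀ v, ∑ d with d.fst = v, w d = 0) :
    ∃ h : C.graph.Dart → ZMod 2, (∀ d, h (C.face d) = h d) ∧ ∀ d, w d = h d + h d.symm := by
  classical
  rcases C.graph.edgeSet.eq_empty_or_nonempty with hE | hE
  · have : IsEmpty C.graph.Dart := ⟨fun d => by simpa [hE] using d.edge_mem⟩
    exact ⟨0, fun d => isEmptyElim d, fun d => isEmptyElim d⟩
  have := Fintype.ofFinite V
  let Q := Quotient (Equiv.Perm.SameCycle.setoid (facePerm C.graph C.rot))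
  have : Fintype Q := Fintype.ofFinite _
  have euler := C.euler hE
  let E := C.graph.edgeSet
  have : Fintype E := Fintype.ofFinite _
  change _ + Nat.card Q = Nat.card E + 2 at euler
  let ed : C.graph.Dart → E := fun d => ⟨d.edge, d.edge_mem⟩
  have hed : ∀ e : E, ∃ d, ed d = e := by
    rintro ⟨e, he⟩
    induction e using Sym2.ind with
    | _ u v => exact ⟨⟨(u, v), he⟩, rfl⟩
  -- `M` is the incidence matrix, whose kernel is the cycle space; `N` below is the boundary map on
  -- sets of faces.
  let M : Matrix V E (ZMod 2) := Matrix.of fun v e => ∑ d with ed d = e, if d.fst = v then 1 else 0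
  let mk : C.graph.Dart → Q := Quotient.mk _
  have hmk : ∀ d, mk (C.face d) = mk d := fun d =>
    Quotient.sound (Equiv.Perm.sameCycle_apply_left.2 (.refl _ _))
  let N : (Q → ZMod 2) →ₗ[ZMod 2] (E → ZMod 2) :=
    { toFun := fun h e => ∑ d with ed d = e, h (mk d)
      map_add' := fun x y => by ext e; simp [sum_add_distrib]
      map_smul' := fun c x => by ext e; simp [mul_sum] }
  have hN : ∀ h d, N h (ed d) = h (mk d) + h (mk d.symm) := fun h d =>
    SimpleGraph.sum_dart_edge_eq (fun d => h (mk d)) d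
  have hM : ∀ z v, M.mulVecLin z v = ∑ d with d.fst = v, z (ed d) := by
    intro z v
    simp only [M, Matrix.mulVecLin_apply, Matrix.mulVec, dotProduct, Matrix.of_apply, sum_mul,
      ite_mul, one_mul, zero_mul]
    rw [sum_filter, ← sum_fiberwise univ ed]
    refine sum_congr rfl fun e _ => sum_congr rfl fun d hd => ?_
    rw [(mem_filter.1 hd).2]
  have hMt : ∀ f d, M.transpose.mulVecLin f (ed d) = f d.fst + f d.snd := by
    intro f d
    rw [show d.snd = d.symm.fst from rfl, ← SimpleGraph.sum_dart_edge_eq (fun d => f d.fst) d]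
    simp only [M, Matrix.mulVecLin_apply, Matrix.mulVec, dotProduct, Matrix.of_apply, sum_mul,
      ite_mul, one_mul, zero_mul, Matrix.transpose_apply]
    rw [sum_comm]
    simp [ed]
  obtain ⟨v₀⟩ := C.connected.nonempty
  have hkerMt : Module.finrank (ZMod 2) (LinearMap.ker M.transpose.mulVecLin) ≤ 1 := by
    refine finrank_le_one ⟨fun _ => 1, ?_⟩ ?_
    · ext e
      obtain ⟨d, rfl⟩ := hed e
      rw [hMt]; rfl
    · rintro ⟨f, hf⟩
      refine ⟨f v₀, Subtype.ext <| funext fun v => ?_⟩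
      have := C.connected.eq_of_forall_adj (f := f) (fun u v huv => by
        have := congrFun hf (ed ⟨(u, v), huv⟩)
        rw [hMt] at this
        exact CharTwo.add_eq_zero.1 this) v₀ v
      simpa using this
  obtain ⟨d₀, -⟩ := hed ⟨_, hE.some_mem⟩
  -- A face function with equal values on both sides of every edge is constant around each vertex,
  -- hence constant by connectedness.
  have hkerN : Module.finrank (ZMod 2) (LinearMap.ker N) ≤ 1 := by
    refine finrank_le_one ⟨fun _ => 1, ?_⟩ ?_
    · ext e
      obtain ⟨d, rfl⟩ := hed e
      rw [hN]; rfl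
    · rintro ⟨h, hh⟩
      have hsymm : ∀ d, h (mk d) = h (mk d.symm) := fun d => by
        have := congrFun hh (ed d)
        rw [hN] at this
        exact CharTwo.add_eq_zero.1 this
      have hrot : ∀ d, h (mk (C.rot d)) = h (mk d) := fun d => by
        rw [← face_symm, hmk, ← hsymm]
      have key : ∀ u v, C.graph.Adj u v → (∀ d, d.fst = u → h (mk d) = h (mk d₀)) →
          ∀ d, d.fst = v → h (mk d) = h (mk d₀) := by
        intro u v huv hu d hd
        rw [eq_of_rot_invariant (s := fun d => h (mk d)) (v := v) (fun d _ => hrot d) hd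
          (d' := ⟨(v, u), huv.symm⟩) rfl, hsymm]
        exact hu _ rfl
      have hall := C.connected.eq_of_forall_adj
        (f := fun v => ∀ d : C.graph.Dart, d.fst = v → h (mk d) = h (mk d₀))
        (fun u v huv => propext ⟨key u v huv, key v u huv.symm⟩) d₀.fst
      refine ⟨h (mk d₀), Subtype.ext <| funext fun q => ?_⟩
      induction q using Quotient.inductionOn with
      | _ d =>
        have := (cast (hall d.fst) fun d hd =>
          eq_of_rot_invariant (s := fun d => h (mk d)) (fun d _ => hrot d) hd rfl) d rfl
        simpa using this.symm
  have hle : LinearMap.range N ≤ LinearMap.ker M.mulVecLin := by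
    rintro _ ⟨h, rfl⟩
    ext v
    rw [hM]
    simp only [hN, sum_add_distrib]
    have : ∑ d with d.fst = v, h (mk d) = ∑ d with d.fst = v, h (mk (C.rot d)) := by
      rw [sum_filter, sum_filter, ← Equiv.sum_comp C.rot]
      simp only [rot_fst]
    rw [this]
    simp only [← face_symm, hmk]
    exact CharTwo.add_self_eq_zero _
  -- The two kernel bounds give rank `N` ≥ F - 1 and rank `M` ≥ V - 1, so by Euler's formula dim ker
  -- `M` ≤ E - V + 1 = F - 1.
  have hrank : LinearMap.range N = LinearMap.ker M.mulVecLin := by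
    refine Submodule.eq_of_le_of_finrank_le hle ?_
    have h1 := LinearMap.finrank_range_add_finrank_ker N
    have h2 := LinearMap.finrank_range_add_finrank_ker M.mulVecLin
    have h3 := LinearMap.finrank_range_add_finrank_ker M.transpose.mulVecLin
    have h4 : Module.finrank (ZMod 2) (LinearMap.range M.transpose.mulVecLin) =
      Module.finrank (ZMod 2) (LinearMap.range M.mulVecLin) := M.rank_transpose
    simp only [Module.finrank_fintype_fun_eq_card, ← Nat.card_eq_fintype_card] at h1 h2 h3
    omega
  let z : E → ZMod 2 := fun e => w (hed e).choose
  have hz : ∀ d, z (ed d) = w d := fun d => by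
    have := (hed (ed d)).choose_spec
    rcases (SimpleGraph.dart_edge_eq_iff _ _).1 (Subtype.ext_iff.1 this) with h | h
    · exact congrArg w h
    · exact (congrArg w h).trans (hw d)
  have hzmem : z ∈ LinearMap.ker M.mulVecLin := by
    ext v
    rw [hM]
    simp only [hz]
    exact hcycle v
  rw [← hrank] at hzmem
  obtain ⟨h, hh⟩ := hzmem
  exact ⟨fun d => h (mk d), fun d => congrArg h (hmk d), fun d => by rw [← hN, hh, hz]⟩

end EmbeddedFlatClusteredGraph

/-! ### Arcs on face boundaries -/

namespace EmbeddedFlatClusteredGraph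

variable {V κ : Type*} (C : EmbeddedFlatClusteredGraph V κ)

open Finset in
/-- The chain formed by the `j` darts of the boundary of a face that start with `a`. -/
def arc [DecidableEq C.graph.Dart] (a : C.graph.Dart) (j : ℕ) (x : C.graph.Dart) : ZMod 2 :=
  ∑ i ∈ range j, if x = C.face^[i] a then 1 else 0

variable {C}

open Finset Function

/-- The sum telescopes, so along a face an arc changes its value only at its two ends. Working
modulo two, no bound on `j` is needed. -/
theorem arc_face_add [DecidableEq C.graph.Dart] (a : C.graph.Dart) (j : ℕ) (x : C.graph.Dart) :
    C.arc a j (C.face x) + C.arc a j x =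
      (if C.face x = a then 1 else 0) + if C.face x = C.face^[j] a then 1 else 0 := by
  have : C.arc a j x = ∑ i ∈ range j, if C.face x = C.face^[i + 1] a then 1 else 0 := by
    simp [arc, iterate_succ_apply']
  rw [this]
  induction j with
  | zero =>
    simp only [arc, range_zero, sum_empty, add_zero, iterate_zero, id_eq]
    exact (CharTwo.add_self_eq_zero _).symm
  | succ j ih =>
    have ih' := ih (by simp [arc, iterate_succ_apply'])
    rw [arc, sum_range_succ, ← arc, sum_range_succ, add_add_add_comm, ih', add_assoc,
      CharTwo.add_cancel_left]

theorem arc_face [DecidableEq C.graph.Dart] {a x : C.graph.Dart} {j : ℕ} (ha : C.face x ≠ a)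
    (hc : C.face x ≠ C.face^[j] a) : C.arc a j (C.face x) = C.arc a j x := by
  have := arc_face_add a j x
  rw [if_neg ha, if_neg hc, add_zero] at this
  exact CharTwo.add_eq_zero.1 this

/-- An arc is a walk: each dart contributes its source and its target, and the inner vertices
cancel. -/
theorem sum_arc_fst [DecidableEq V] [Fintype C.graph.Dart] [DecidableEq C.graph.Dart]
    (a : C.graph.Dart) (j : ℕ) (v : V) :
    ∑ d with d.fst = v, (C.arc a j d + C.arc a j d.symm) =
      (if a.fst = v then 1 else 0) + if (C.face^[j] a).fst = v then 1 else 0 := by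
  induction j with
  | zero =>
    simp only [arc, range_zero, sum_empty, add_zero, sum_const_zero, iterate_zero, id_eq]
    exact (CharTwo.add_self_eq_zero _).symm
  | succ j ih =>
    simp only [arc, sum_range_succ] at ih ⊢
    have h1 : ∑ d : C.graph.Dart with d.fst = v, (if d = C.face^[j] a then (1 : ZMod 2) else 0) =
        if (C.face^[j] a).fst = v then 1 else 0 := by
      rw [sum_ite_eq']; simp
    have h2 : ∑ d : C.graph.Dart with d.fst = v,
        (if d.symm = C.face^[j] a then (1 : ZMod 2) else 0) =
        if (C.face^[j + 1] a).fst = v then 1 else 0 := by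
      rw [iterate_succ_apply', face_fst]
      have (d : C.graph.Dart) : d.symm = C.face^[j] a ↔ d = (C.face^[j] a).symm :=
        SimpleGraph.Dart.symm_involutive.eq_iff
      simp only [this]
      rw [sum_ite_eq']; simp
    calc _ = ∑ d with d.fst = v, (C.arc a j d + C.arc a j d.symm) +
        (∑ d : C.graph.Dart with d.fst = v, (if d = C.face^[j] a then (1 : ZMod 2) else 0) + 
          ∑ d : C.graph.Dart with d.fst = v,
        (if d.symm = C.face^[j] a then (1 : ZMod 2) else 0)) := by
          rw [← sum_add_distrib, ← sum_add_distrib]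
          exact sum_congr rfl fun d _ => add_add_add_comm _ _ _ _
      _ = _ := by
        simp only [arc]
        rw [ih, h1, h2, add_assoc, CharTwo.add_cancel_left]

theorem arc_iterate [DecidableEq C.graph.Dart] {a : C.graph.Dart} {j m : ℕ}
    (hj : j < minimalPeriod C.face a) (hm : m < minimalPeriod C.face a) :
    C.arc a j (C.face^[m] a) = if m < j then 1 else 0 := by
  have : ∀ i ∈ range j, (C.face^[m] a = C.face^[i] a ↔ m = i) := fun i hi => by
    have := mem_range.1 hi
    exact iterate_eq_iterate_iff_of_lt_minimalPeriod hm (by omega)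
  rw [arc, sum_congr rfl fun i hi => if_congr (this i hi) rfl rfl]
  simp

theorem arc_eq_zero [DecidableEq C.graph.Dart] {a x : C.graph.Dart} (j : ℕ)
    (hx : ¬ C.face.SameCycle a x) : C.arc a j x = 0 := by
  refine sum_eq_zero fun i _ => if_neg ?_
  rintro rfl
  exact hx ⟨i, by rw [zpow_natCast, ← Equiv.Perm.iterate_eq_pow]⟩

theorem sameCycle_iff_exists_iterate [Finite V] {a x : C.graph.Dart} :
    C.face.SameCycle a x ↔ ∃ m < minimalPeriod C.face a, x = C.face^[m] a := by
  classical
  have := Fintype.ofFinite V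
  have : Finite C.graph.Dart := Finite.of_injective SimpleGraph.Dart.toProd
    SimpleGraph.Dart.toProd_injective
  constructor
  · intro h
    obtain ⟨n, rfl⟩ := h.exists_nat_pow_eq
    refine ⟨n % minimalPeriod C.face a, Nat.mod_lt _ ?_, ?_⟩
    · exact minimalPeriod_pos_of_mem_periodicPts (C.face.injective.mem_periodicPts a)
    · rw [iterate_mod_minimalPeriod_eq, Equiv.Perm.iterate_eq_pow]
  · rintro ⟨m, -, rfl⟩
    exact ⟨m, by rw [zpow_natCast, ← Equiv.Perm.iterate_eq_pow]⟩

/-- An arc separates two other occurrences of a face only if the chords alternate. -/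
theorem arc_eq_of_not_conflict [Finite V] [DecidableEq C.graph.Dart] {a b d : C.graph.Dart} {j : ℕ}
    (hj : j < minimalPeriod C.face a) (hbd : C.face.SameCycle b d)
    (hb : b ≠ a) (hb' : b ≠ C.face^[j] a) (hd : d ≠ a) (hd' : d ≠ C.face^[j] a)
    (hc : ¬ C.Conflict s(a, C.face^[j] a) s(b, d)) : C.arc a j b = C.arc a j d := by
  by_cases hab : C.face.SameCycle a b
  · obtain ⟨m, hm, rfl⟩ := sameCycle_iff_exists_iterate.1 hab
    obtain ⟨n, hn, rfl⟩ := sameCycle_iff_exists_iterate.1 (hab.trans hbd)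
    rw [arc_iterate hj hm, arc_iterate hj hn]
    have hm0 : m ≠ 0 := by rintro rfl; exact hb rfl
    have hn0 : n ≠ 0 := by rintro rfl; exact hd rfl
    have hmj : m ≠ j := by rintro rfl; exact hb' rfl
    have hnj : n ≠ j := by rintro rfl; exact hd' rfl
    by_cases h1 : m < j <;> by_cases h2 : n < j <;> simp only [h1, h2, if_true, if_false]
    · exact (hc ⟨a, _, _, _, rfl, rfl, m, j, n, by omega, h1, by omega, hn, rfl, rfl, rfl⟩).elim
    · exact (hc ⟨a, _, _, _, rfl, Sym2.eq_swap, n, j, m, by omega, h2, by omega, hm, rfl, rfl,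
        rfl⟩).elim
  · rw [arc_eq_zero j hab, arc_eq_zero j fun h => hab (h.trans hbd.symm)]

end EmbeddedFlatClusteredGraph

/-! ### Curves inside a cluster and their sides -/

namespace EmbeddedFlatClusteredGraph

variable {V κ : Type*} (C : EmbeddedFlatClusteredGraph V κ)

open Finset Function

/-- `g` and `I` describe, modulo two, a curve from `u` to `v` that avoids the vertices outside of
the cluster `α`: `g` consists of edges of `G[α]`, and `I` of arcs on the boundaries of faces, which
replace chords with both ends in `α`. -/
structure IsChain [DecidableEq V] [Fintype C.graph.Dart] (α : κ) (u v : V)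
    (g I : C.graph.Dart → ZMod 2) : Prop where
  symm : ∀ d, g d.symm = g d
  eq_zero : ∀ d, C.cluster d.fst ≠ some α → g d = 0
  face : ∀ d, C.cluster (C.face d).fst ≠ some α → I (C.face d) = I d
  boundary : ∀ w, ∑ d with d.fst = w, (g d + (I d + I d.symm)) =
    (if u = w then 1 else 0) + if v = w then 1 else 0

/-- The vertices `u` and `v` can be joined by a curve inside `α` that crosses every pair of
occurrences in `X` an even number of times. -/
def Linked [DecidableEq V] [Fintype C.graph.Dart] (X : Set (Sym2 C.Occurrence)) (α : κ)
    (u v : V) : Prop :=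
  ∃ g I, C.IsChain α u v g I ∧ ∀ b d, s(b, d) ∈ X → I b = I d

variable {C}

theorem IsConEdge.exists_of_ends {α : κ} {u v : V} {e : Sym2 C.Occurrence} (he : C.IsConEdge e)
    (huv : C.ends e = s(u, v)) (hu : C.cluster u = some α) :
    C.IsConEdgeFor α e ∧
      ∃ a c : C.Occurrence, e = s(a, c) ∧ a.fst = u ∧ c.fst = v ∧ C.face.SameCycle a c := by
  obtain ⟨α', a, c, ha, hc, rfl, hac, hr⟩ := he
  rcases Sym2.eq_iff.1 (show s(a.fst, c.fst) = s(u, v) from huv) with ⟨rfl, rfl⟩ | ⟨rfl, rfl⟩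
  · obtain rfl : α' = α := Option.some_injective _ (ha.symm.trans hu)
    exact ⟨⟨a, c, ha, hc, rfl, hac, hr⟩, a, c, rfl, rfl, rfl, hac⟩
  · obtain rfl : α' = α := Option.some_injective _ (hc.symm.trans hu)
    exact ⟨⟨a, c, ha, hc, rfl, hac, hr⟩, c, a, Sym2.eq_swap, rfl, rfl, hac.symm⟩

variable [DecidableEq V] [Fintype C.graph.Dart] {X : Set (Sym2 C.Occurrence)} {α : κ}
  {u v w : V}

theorem IsChain.trans {g I g' I' : C.graph.Dart → ZMod 2} (h : C.IsChain α u v g I)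
    (h' : C.IsChain α v w g' I') : C.IsChain α u w (g + g') (I + I') where
  symm d := by simp [h.symm, h'.symm]
  eq_zero d hd := by simp [h.eq_zero d hd, h'.eq_zero d hd]
  face d hd := by simp [h.face d hd, h'.face d hd]
  boundary x := by
    calc _ = ∑ d with d.fst = x, (g d + (I d + I d.symm)) +
          ∑ d with d.fst = x, (g' d + (I' d + I' d.symm)) := by
          rw [← sum_add_distrib]
          exact sum_congr rfl fun d _ => by simp only [Pi.add_apply]; abel
      _ = _ := by rw [h.boundary, h'.boundary, add_assoc, CharTwo.add_cancel_left]

theorem Linked.refl (u : V) : C.Linked X α u u :=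
  ⟨0, 0, ⟨fun _ => rfl, fun _ _ => rfl, fun _ _ => rfl, fun w => by
    simpa using (CharTwo.add_self_eq_zero _).symm⟩, fun _ _ _ => rfl⟩

theorem Linked.symm : C.Linked X α u v → C.Linked X α v u
  | ⟨g, I, h, hX⟩ => ⟨g, I, ⟨h.symm, h.eq_zero, h.face, fun w => by
    rw [h.boundary, add_comm]⟩, hX⟩

theorem Linked.trans : C.Linked X α u v → C.Linked X α v w → C.Linked X α u w
  | ⟨_, _, h, hX⟩, ⟨_, _, h', hX'⟩ =>
    ⟨_, _, h.trans h', fun b d hbd => by simp [hX b d hbd, hX' b d hbd]⟩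

theorem linked_of_adj (hu : C.cluster u = some α) (hv : C.cluster v = some α)
    (huv : C.graph.Adj u v) : C.Linked X α u v := by
  classical
  let e : C.graph.Dart := ⟨(u, v), huv⟩
  have hs (d : C.graph.Dart) : d.symm = e ↔ d = e.symm :=
    SimpleGraph.Dart.symm_involutive.eq_iff
  refine ⟨fun d => (if d = e then 1 else 0) + if d.symm = e then 1 else 0, 0,
    ⟨?_, ?_, fun _ _ => rfl, ?_⟩, fun _ _ _ => rfl⟩
  · intro d
    rw [SimpleGraph.Dart.symm_symm, add_comm]
  · intro d hd
    rw [if_neg, if_neg, add_zero]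
    · rw [hs]
      rintro rfl
      exact hd hv
    · rintro rfl
      exact hd hu
  · intro w
    simp only [Pi.zero_apply, add_zero, sum_add_distrib, hs, sum_ite_eq', mem_filter, mem_univ,
      true_and]
    rfl

/-- The arc may pass through vertices outside `α`; this is harmless, because it stands for the chord
between its ends, and only these have to lie in `α`. -/
theorem isChain_arc [DecidableEq C.graph.Dart] {a : C.graph.Dart} {j : ℕ}
    (ha : C.cluster a.fst = some α) (hc : C.cluster (C.face^[j] a).fst = some α) :
    C.IsChain α a.fst (C.face^[j] a).fst 0 (C.arc a j) where
  symm _ := rfl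
  eq_zero _ _ := rfl
  face d hd := arc_face (fun h => hd (h ▸ ha)) fun h => hd (h ▸ hc)
  boundary w := by simpa using sum_arc_fst a j w

/-- A closed curve inside `α` separates the plane: the other vertices can be two-coloured
according to their side. -/
theorem IsChain.exists_side [Finite V] {g I : C.graph.Dart → ZMod 2} (h : C.IsChain α u u g I) :
    ∃ f : V → ZMod 2,
      (∀ v w, C.cluster v ≠ some α → C.graph.Adj v w → C.cluster w ≠ some α → f v = f w) ∧
      ∀ b d : C.Occurrence, C.face.SameCycle b d → C.cluster b.fst ≠ some α →
        C.cluster d.fst ≠ some α → f b.fst + f d.fst = I b + I d := by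
  classical
  obtain ⟨p, hp, hpI⟩ := exists_face_potential (fun d => g d + (I d + I d.symm))
    (fun d => by rw [h.symm, SimpleGraph.Dart.symm_symm, add_comm (I _)])
    (fun v => (h.boundary v).trans (CharTwo.add_self_eq_zero _))
  -- The potential `p` also jumps across the arcs. Adding `I` removes these jumps, which amounts to
  -- pushing each arc back to its chord inside the face.
  let s : C.graph.Dart → ZMod 2 := fun d => p d + I d
  have hs : ∀ d, C.cluster d.fst ≠ some α → s d.symm = s d := fun d hd => by
    have := hpI d
    rw [h.eq_zero d hd, zero_add] at this
    rw [← CharTwo.add_eq_zero, add_add_add_comm, add_comm (p _), ← this, add_comm (I d),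
      CharTwo.add_self_eq_zero]
  have hface : ∀ d, C.cluster (C.face d).fst ≠ some α → s (C.face d) = s d := fun d hd => by
    simp only [s, hp, h.face d hd]
  have hrot : ∀ d, C.cluster d.fst ≠ some α → s (C.rot d) = s d := fun d hd => by
    rw [← face_symm, hface _ (by rwa [face_symm, rot_fst]), hs d hd]
  -- The default value only concerns isolated vertices, which have neither neighbours nor
  -- occurrences.
  let f : V → ZMod 2 := fun v => if hv : ∃ d : C.graph.Dart, d.fst = v then s hv.choose else 0
  have hf : ∀ d : C.graph.Dart, C.cluster d.fst ≠ some α → f d.fst = s d := fun d hd => by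
    have hex : ∃ d' : C.graph.Dart, d'.fst = d.fst := ⟨d, rfl⟩
    simp only [f, dif_pos hex]
    exact eq_of_rot_invariant (v := d.fst) (fun d' hd' => hrot d' (hd' ▸ hd)) hex.choose_spec rfl
  refine ⟨f, fun v w hv hvw hw => ?_, fun b d hbd hb hd => ?_⟩
  · let d : C.graph.Dart := ⟨(v, w), hvw⟩
    exact (hf d hv).trans ((hs d hv).symm.trans (hf d.symm hw).symm)
  · have : p b = p d := by
      obtain ⟨m, -, rfl⟩ := sameCycle_iff_exists_iterate.1 hbd
      clear hbd hd
      induction m with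
      | zero => rfl
      | succ m ih => rw [ih, iterate_succ_apply', hp]
    rw [hf b hb, hf d hd, add_add_add_comm, this, CharTwo.add_self_eq_zero, zero_add]

end EmbeddedFlatClusteredGraph

/-! ### Crossing the spanning trees of two clusters -/

namespace ConEdgeMultigraph

variable {V κ : Type*} {C : EmbeddedFlatClusteredGraph V κ} {A : ConEdgeMultigraph C}

/-- Induction along walks, using only that the tree is connected. It serves both clusters: with
`Linked` to build the curve in one, and with equality of sides for the other. -/
theorem IsSpanningTree.rel {S : Set (Sym2 C.Occurrence)} {α : κ} (h : A.IsSpanningTree S α)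
    (r : Setoid V)
    (hadj : ∀ u v, C.cluster u = some α → C.cluster v = some α → C.graph.Adj u v → r u v)
    (hS : ∀ e ∈ S ∪ A.contracted, ∀ u v, C.cluster u = some α → C.cluster v = some α →
      C.ends e = s(u, v) → r u v) {u v : V} (hu : C.cluster u = some α)
    (hv : C.cluster v = some α) : r u v := by
  have hcontr : ∀ u v : {v : V // C.cluster v = some α},
      (A.contractionGraph α).Reachable u v → r u.1 v.1 := by
    rintro u v ⟨p⟩
    induction p with
    | nil => exact r.refl _
    | @cons u v _ h _ ih =>
      refine r.trans ?_ ih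
      rcases h with h | ⟨-, ⟨e, he, h⟩ | ⟨e, he, h⟩⟩
      · exact hadj _ _ u.2 v.2 h
      · exact hS e (.inr he) _ _ u.2 v.2 h
      · exact r.symm (hS e (.inr he) _ _ v.2 u.2 h)
  have hjoin : ∀ e ∈ S, ∀ x y : A.Vertex α, A.Joins e x y →
      ∀ u v, (A.contractionGraph α).connectedComponentMk u = x →
        (A.contractionGraph α).connectedComponentMk v = y → r u.1 v.1 := by
    rintro e he x y ⟨u', v', h, rfl, rfl⟩ u v hu hv
    exact r.trans (hcontr _ _ (SimpleGraph.ConnectedComponent.exact hu)) <|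
      r.trans (hS e (.inl he) _ _ u'.2 v'.2 h)
        (r.symm (hcontr _ _ (SimpleGraph.ConnectedComponent.exact hv)))
  obtain ⟨p⟩ := h.2.2.1.preconnected ((A.contractionGraph α).connectedComponentMk ⟨u, hu⟩)
    ((A.contractionGraph α).connectedComponentMk ⟨v, hv⟩)
  have key : ∀ x y : A.Vertex α, (SimpleGraph.fromRel fun x y : A.Vertex α =>
      ∃ e ∈ S, A.Joins e x y).Walk x y → ∀ u v,
      (A.contractionGraph α).connectedComponentMk u = x →
        (A.contractionGraph α).connectedComponentMk v = y → r u.1 v.1 := by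
    intro x y p
    induction p with
    | nil =>
      intro u v hu hv
      exact hcontr _ _ (SimpleGraph.ConnectedComponent.exact (hu.trans hv.symm))
    | @cons x y z h _ ih =>
      intro u v hu hv
      obtain ⟨t, ht⟩ := y.exists_rep
      refine r.trans ?_ (ih t v ht hv)
      rcases h with ⟨-, ⟨e, he, h⟩ | ⟨e, he, h⟩⟩
      · exact hjoin e he _ _ h _ _ hu ht
      · exact r.symm (hjoin e he _ _ h _ _ ht hu)
  exact key _ _ p ⟨u, hu⟩ ⟨v, hv⟩ rfl rfl

open EmbeddedFlatClusteredGraph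

/-- Of two con-edges that have a conflict, one belongs to the planar set of spanning trees. -/
theorem IsPlanarSetOfSpanningTrees.mem_or_mem [Finite V] {S : Set (Sym2 C.Occurrence)}
    (hS : A.IsPlanarSetOfSpanningTrees S) (hA : A.SeparatesClusters) {e e' : A.edges}
    (hee : A.conflictGraph.Adj e e') : e.1 ∈ S ∨ e'.1 ∈ S := by
  classical
  have := Fintype.ofFinite V
  have : Fintype C.graph.Dart := @Fintype.ofFinite _ (Finite.of_injective
    SimpleGraph.Dart.toProd SimpleGraph.Dart.toProd_injective)
  by_contra! hn
  obtain ⟨heS, heS'⟩ := hn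
  obtain ⟨e, he⟩ := e
  obtain ⟨e', he'⟩ := e'
  have hconf : C.Conflict e e' := hee
  obtain ⟨a, b, c, d, rfl, rfl, i, j, k, hi, hij, hjk, hk, rfl, rfl, rfl⟩ := id hconf
  obtain ⟨α, hα⟩ := A.isConEdge _ (.inl he)
  obtain ⟨β, hβ⟩ := A.isConEdge _ (.inl he')
  have hαβ : α ≠ β := by
    rintro rfl
    have := hA α _ _ hα hβ hee.reachable
    exact hee.ne this
  have hends : ∀ {γ : κ} {x y : C.Occurrence}, C.IsConEdgeFor γ s(x, y) →
      C.cluster x.fst = some γ ∧ C.cluster y.fst = some γ ∧ C.face.SameCycle x y := by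
    rintro γ x y ⟨x', y', hx, hy, h, hxy, -⟩
    rcases Sym2.eq_iff.1 h with ⟨rfl, rfl⟩ | ⟨rfl, rfl⟩
    exacts [⟨hx, hy, hxy⟩, ⟨hy, hx, hxy.symm⟩]
  have hne : ∀ {x y : C.Occurrence}, C.cluster x.fst = some β → C.cluster y.fst = some α →
      x ≠ y := by
    rintro x _ hx hy rfl
    exact hαβ (Option.some_injective _ (hy.symm.trans hx))
  have hcon : ∀ f ∈ S ∪ A.contracted, C.IsConEdge f := fun f hf =>
    A.isConEdge f (hf.imp (fun h => hS.subset h) id)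
  -- Con-edges of the two clusters that are present cross at most in the given pair.
  have hSS : ∀ f ∈ S ∪ A.contracted, ∀ f' ∈ S ∪ A.contracted, ¬ C.Conflict f f' := by
    rintro f (hf | hf) f' (hf' | hf') h
    · exact hS.not_conflict f hf f' hf' h
    · exact A.not_conflict f' hf' f (.inl (hS.subset hf)) h.symm
    · exact A.not_conflict f hf f' (.inl (hS.subset hf')) h
    · exact A.not_conflict f hf f' (.inr hf') h
  -- A crossing `f` from `S` would be in the component of the first con-edge, hence equal to it,
  -- which is not in `S`.
  have hαe' : ∀ f ∈ S ∪ A.contracted, C.IsConEdgeFor α f →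
      ¬ C.Conflict f s(C.face^[i] a, C.face^[k] a) := by
    rintro f (hf | hf) hfα h
    · have hadj : A.conflictGraph.Adj ⟨f, hS.subset hf⟩ ⟨_, he'⟩ := h
      have := hA α _ _ hfα hα (hadj.reachable.trans hee.reachable.symm)
      exact heS (Subtype.ext_iff.1 this ▸ hf)
    · exact A.not_conflict f hf _ (.inl he') h
  have hβe : ∀ f ∈ S ∪ A.contracted, C.IsConEdgeFor β f →
      ¬ C.Conflict s(a, C.face^[j] a) f := by
    rintro f (hf | hf) hfβ h
    · have hadj : A.conflictGraph.Adj ⟨_, he⟩ ⟨f, hS.subset hf⟩ := h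
      have := hA β _ _ hfβ hβ (hadj.reachable.symm.trans hee.reachable)
      exact heS' (Subtype.ext_iff.1 this ▸ hf)
    · exact A.not_conflict f hf _ (.inl he) h.symm
  obtain ⟨haα, hcα, hac⟩ := hends hα
  obtain ⟨hbβ, hdβ, hbd⟩ := hends hβ
  -- The pairs that the curve from c to a must not cross: the missing con-edge bd and whatever joins
  -- up the cluster `β`.
  let X : Set (Sym2 C.Occurrence) :=
    insert s(C.face^[i] a, C.face^[k] a) {f ∈ S ∪ A.contracted | C.IsConEdgeFor β f}
  have hX : ∀ f ∈ X, C.IsConEdgeFor β f := by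
    rintro f (rfl | hf)
    exacts [hβ, hf.2]
  let r : Setoid V := ⟨C.Linked X α, Linked.refl, Linked.symm, Linked.trans⟩
  obtain ⟨g, I, hgI, hI⟩ : C.Linked X α (C.face^[j] a).fst a.fst := by
    refine (hS.isSpanningTree α).rel r (fun u v hu hv h => linked_of_adj hu hv h) ?_ hcα haα
    intro f hf u v hu hv huv
    obtain ⟨hfα, x, y, rfl, rfl, rfl, hxy⟩ := (hcon f hf).exists_of_ends huv hu
    obtain ⟨m, hm, rfl⟩ := sameCycle_iff_exists_iterate.1 hxy
    refine ⟨0, C.arc x m, isChain_arc hu hv, fun y z hyz => ?_⟩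
    obtain ⟨hy, hz, hyz'⟩ := hends (hX _ hyz)
    refine arc_eq_of_not_conflict hm hyz' (hne hy hu) (hne hy hv) (hne hz hu) (hne hz hv) ?_
    rcases hyz with h | hyz
    · rw [h]; exact hαe' _ hf hfα
    · exact hSS _ hf _ hyz.1
  obtain ⟨f, hfadj, hfI⟩ := ((isChain_arc haα hcα).trans hgI).exists_side
  have hβα : ∀ {v}, C.cluster v = some β → C.cluster v ≠ some α := fun hv h =>
    hαβ (Option.some_injective _ (h.symm.trans hv))
  have hfβ : f (C.face^[i] a).fst = f (C.face^[k] a).fst := by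
    refine (hS.isSpanningTree β).rel (Setoid.ker f)
      (fun u v hu hv h => hfadj u v (hβα hu) h (hβα hv)) ?_ hbβ hdβ
    intro t ht u v hu hv huv
    obtain ⟨htβ, x, y, rfl, rfl, rfl, hxy⟩ := (hcon t ht).exists_of_ends huv hu
    refine CharTwo.add_eq_zero.1 ((hfI x y hxy (hβα hu) (hβα hv)).trans ?_)
    rw [CharTwo.add_eq_zero, Pi.add_apply, Pi.add_apply, hI x y (.inr ⟨ht, htβ⟩),
      arc_eq_of_not_conflict (by omega) hxy (hne hu haα) (hne hu hcα) (hne hv haα) (hne hv hcα)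
        (hβe _ ht htβ)]
  -- The part `I` agrees at b and d, but the arc from a to c contains b and not d, as `i < j < k`;
  -- so b and d lie on different sides.
  have := hfI _ _ hbd (hβα hbβ) (hβα hdβ)
  rw [CharTwo.add_eq_zero.2 hfβ, eq_comm, CharTwo.add_eq_zero, Pi.add_apply, Pi.add_apply,
    hI _ _ (.inl rfl), add_left_inj, arc_iterate (by omega) (by omega),
    arc_iterate (by omega) hk, if_pos hij, if_neg (by omega)] at this
  exact one_ne_zero this

end ConEdgeMultigraph

theorem mainTheorem7 {V κ : Type*} [Finite V] (C : EmbeddedFlatClusteredGraph V κ)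
    (A : ConEdgeMultigraph C) (hA : A.SeparatesClusters)
    (hK : ¬ A.conflictGraph.IsBipartite) :
    ¬ ∃ S : Set (Sym2 C.Occurrence), A.IsPlanarSetOfSpanningTrees S := by
  classical
  rintro ⟨S, hS⟩
  refine hK ⟨SimpleGraph.Coloring.mk (fun e => if e.1 ∈ S then 0 else 1) ?_⟩
  intro e e' h
  rcases hS.mem_or_mem hA h with he | he
  · rw [if_pos he, if_neg fun he' => hS.not_conflict _ he _ he' h]
    exact zero_ne_one
  · rw [if_pos he, if_neg fun he' => hS.not_conflict _ he' _ he h]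
    exact one_ne_zero
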